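/- Let $X$ be a regular topological space (every closed set and every point outside it have disjoint neighbourhoods). Suppose that $X$ is Lindelöf-generated, that is, a set $A\subseteq X$ is open in $X$ whenever $A\cap L$ is open in $L$ for every Lindelöf subspace $L\subseteq X$. Let $\Delta(X)$, the dispersion character of $X$, denote the smallest cardinality of a nonempty open subset of $X$. If $|X|=\Delta(X)=\omega_1$, then $X$ is $\omega_1$-resolvable, that is, there is a family of $\omega_1$ many pairwise disjoint dense subsets of $X$. -/

import Mathlib

universe u

/-- `X` is Lindelöf-generated: a set `A ⊆ X` is open as soon as `A ∩ L` is open in `L` for every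
Lindelöf subspace `L` of `X`. -/
def LindelofGenerated (X : Type u) [TopologicalSpace X] : Prop :=
  Topology.IsCoherentWith {L : Set X | IsLindelof L}

/-- The dispersion character `Δ(X)`: the least cardinality of a nonempty open subset of `X`. -/
noncomputable def dispersionCharacter (X : Type u) [TopologicalSpace X] : Cardinal.{u} :=
  sInf {κ : Cardinal.{u} | ∃ U : Set X, IsOpen U ∧ U.Nonempty ∧ Cardinal.mk U = κ}

/-- `X` is `κ`-resolvable: it has `κ` many pairwise disjoint dense subsets. -/
def Resolvable (κ : Cardinal.{u}) (X : Type u) [TopologicalSpace X] : Prop :=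
  ∃ 𝓓 : Set (Set X), Cardinal.mk 𝓓 = κ ∧ (∀ D ∈ 𝓓, Dense D) ∧ 𝓓.PairwiseDisjoint id

open Set Filter Topology Cardinal

/-! ### Almost disjoint families of uncountable sets -/

section SetTheory

/-! Take a maximal saturated family `𝒦` and let `Z` be the set of points where some member
condenses. Each point of `Z` has more than `ℵ₁` members condensing at it, so distinct members can be
assigned to all pairs `(z, γ)`; subtracting the countably many earlier ones makes them disjoint
(`exists_disjoint_subsets_condensing`). Off the closure of `Z`, maximality makes every Lindelöf
subset countable (`Maximal.countable_of_isLindelof`), which yields countable tightness there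
(`exists_countable_mem_closure`), and disjoint countable sets accumulating at each point are chosen
by recursion. The dense set with index `γ` collects the pieces labelled `γ`. -/

theorem exists_wellOrder_countable_initial {I : Type u} (h : #I ≤ aleph 1) :
    ∃ r : I → I → Prop, IsWellOrder I r ∧ ∀ i, {j | r j i}.Countable := by
  obtain ⟨r, hr, hI⟩ := Cardinal.exists_ord_eq I
  refine ⟨r, hr, fun i => ?_⟩
  have h1 := (Cardinal.card_typein_lt i hI).trans_le h
  rw [← Cardinal.le_aleph0_iff_set_countable]
  exact Cardinal.lt_aleph_one_iff.1 h1

theorem exists_choice_of_earlier {I : Type*} {α : Type*} {r : I → I → Prop} (hr : WellFounded r)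
    (Q : ∀ i, ({j // r j i} → α) → α → Prop) (h : ∀ i f, ∃ a, Q i f a) :
    ∃ F : I → α, ∀ i, Q i (fun j => F j) (F i) := by
  choose g hg using h
  refine ⟨hr.fix fun i ih => g i fun j => ih j j.2, fun i => ?_⟩
  rw [hr.fix_eq]
  exact hg i _

theorem exists_injective_choice {I α : Type u} (hI : #I ≤ aleph 1) (S : I → Set α)
    (hS : ∀ i, aleph 1 < #(S i)) : ∃ F : I → α, Function.Injective F ∧ ∀ i, F i ∈ S i := by
  obtain ⟨r, hr, hc⟩ := exists_wellOrder_countable_initial hI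
  obtain ⟨F, hF⟩ := exists_choice_of_earlier hr.wf
    (fun i f a => a ∈ S i ∧ a ∉ range f) fun i f => by
      by_contra! hcon
      have h1 : #(S i) ≤ #(range f) := Cardinal.mk_le_mk_of_subset hcon
      have h2 : #(range f) ≤ aleph 1 :=
        (Cardinal.mk_range_le.trans (Cardinal.mk_subtype_le _)).trans hI
      exact absurd (hS i) (not_lt.2 (h1.trans h2))
  refine ⟨F, fun i j hij => ?_, fun i => (hF i).1⟩
  rcases trichotomous_of r i j with h | h | h
  · exact absurd ⟨⟨i, h⟩, hij⟩ (hF j).2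
  · exact h
  · exact absurd ⟨⟨j, h⟩, hij.symm⟩ (hF i).2

variable {X : Type u}

/-- Uncountable sets with pairwise countable intersections. -/
structure IsAlmostDisjoint (𝒜 : Set (Set X)) : Prop where
  not_countable : ∀ A ∈ 𝒜, ¬ A.Countable
  countable_inter : ∀ A ∈ 𝒜, ∀ B ∈ 𝒜, A ≠ B → (A ∩ B).Countable

theorem IsAlmostDisjoint.mono {𝒜 ℬ : Set (Set X)} (h : IsAlmostDisjoint ℬ) (hs : 𝒜 ⊆ ℬ) :
    IsAlmostDisjoint 𝒜 :=
  ⟨fun A hA => h.1 A (hs hA), fun A hA B hB => h.2 A (hs hA) B (hs hB)⟩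

theorem IsAlmostDisjoint.sUnion {c : Set (Set (Set X))} (hc : IsChain (· ⊆ ·) c)
    (h : ∀ 𝒜 ∈ c, IsAlmostDisjoint 𝒜) : IsAlmostDisjoint (⋃₀ c) := by
  refine ⟨fun A ⟨𝒜, h𝒜, hA⟩ => (h 𝒜 h𝒜).1 A hA, fun A ⟨𝒜, h𝒜, hA⟩ B ⟨ℬ, hℬ, hB⟩ hAB => ?_⟩
  rcases hc.total h𝒜 hℬ with hs | hs
  · exact (h ℬ hℬ).2 A (hs hA) B hB hAB
  · exact (h 𝒜 h𝒜).2 A hA B (hs hB) hAB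

theorem not_countable_of_aleph_one_le {α : Type u} {s : Set α} (h : aleph 1 ≤ #s) :
    ¬ s.Countable := fun hs =>
  absurd (Cardinal.aleph_one_le_iff.1 h) (not_lt.2 (Cardinal.le_aleph0_iff_set_countable.2 hs))

theorem exists_uncountable_partition {L : Set X} (hL : #L = aleph 1) :
    ∃ ℬ : Set (Set X), IsAlmostDisjoint ℬ ∧ (∀ A ∈ ℬ, A ⊆ L) ∧ ¬ ℬ.Countable := by
  have hmul : #L = #(L × L) := by
    rw [Cardinal.mk_prod, Cardinal.lift_id, hL, Cardinal.mul_eq_self (Cardinal.aleph0_le_aleph 1)]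
  obtain ⟨e⟩ := Cardinal.eq.1 hmul
  let P : L → Set X := fun l => range fun m : L => ((e.symm (l, m) : L) : X)
  have hinj : ∀ l, Function.Injective fun m : L => ((e.symm (l, m) : L) : X) := by
    intro l m m' h
    have := e.symm.injective (Subtype.ext h)
    exact (Prod.ext_iff.1 this).2
  have hdis : ∀ l l' x, x ∈ P l → x ∈ P l' → l = l' := by
    rintro l l' x ⟨m, rfl⟩ ⟨m', h⟩
    have := e.symm.injective (Subtype.ext h)
    exact (Prod.ext_iff.1 this).1.symm
  have hP : ∀ l, ¬ (P l).Countable := fun l =>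
    not_countable_of_aleph_one_le (by rw [Cardinal.mk_range_eq _ (hinj l), hL])
  have hPinj : Function.Injective P := by
    intro l l' h
    obtain ⟨x, hx⟩ : (P l).Nonempty := by
      by_contra hne
      exact hP l (by simp [not_nonempty_iff_eq_empty.1 hne])
    exact hdis l l' x hx (h ▸ hx)
  refine ⟨range P, ⟨?_, ?_⟩, ?_, ?_⟩
  · rintro _ ⟨l, rfl⟩
    exact hP l
  · rintro _ ⟨l, rfl⟩ _ ⟨l', rfl⟩ hne
    have : P l ∩ P l' = ∅ := by
      ext x
      simp only [mem_inter_iff, mem_empty_iff_false, iff_false]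
      rintro ⟨h, h'⟩
      exact hne (congrArg P (hdis l l' x h h'))
    simp [this]
  · rintro _ ⟨l, rfl⟩ _ ⟨m, rfl⟩
    exact Subtype.coe_prop _
  · exact not_countable_of_aleph_one_le (by rw [Cardinal.mk_range_eq _ hPinj, hL])

/-- Diagonalisation along a well-order with countable initial segments: the point chosen at stage
`i` avoids all earlier members, so a given member only contains points chosen up to its own stage.
-/
theorem IsAlmostDisjoint.exists_countable_inter {𝒜 : Set (Set X)} (h : IsAlmostDisjoint 𝒜)
    {L : Set X} (hL : ∀ A ∈ 𝒜, A ⊆ L) (hunc : ¬ 𝒜.Countable) (hcard : #𝒜 ≤ aleph 1) :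
    ∃ B ⊆ L, ¬ B.Countable ∧ ∀ A ∈ 𝒜, (B ∩ A).Countable := by
  obtain ⟨r, hr, hc⟩ := exists_wellOrder_countable_initial hcard
  obtain ⟨b, hb⟩ := exists_choice_of_earlier hr.wf
    (fun i (f : {j // r j i} → X) x => x ∈ L ∧ ∀ j, x ∉ (j.1 : Set X) ∧ x ≠ f j) fun i f => by
      have : Countable {j // r j i} := (hc i).to_subtype
      -- A member other than the earlier ones meets their union in a countable set, so it has points
      -- to spare.
      obtain ⟨A, hA, hAi⟩ : ∃ A ∈ 𝒜, ∀ j : {j // r j i}, A ≠ j.1 := by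
        by_contra! hcon
        refine hunc ((countable_range fun j : {j // r j i} => (j.1 : Set X)).mono fun A hA => ?_)
        obtain ⟨j, hj⟩ := hcon A hA
        exact ⟨j, hj.symm⟩
      have hcount : (⋃ j : {j // r j i}, (A ∩ j.1 ∪ {f j})).Countable :=
        countable_iUnion fun j =>
          (h.2 A hA _ j.1.2 (hAi j)).union (countable_singleton _)
      obtain ⟨x, hxA, hx⟩ : ∃ x ∈ A, x ∉ ⋃ j : {j // r j i}, (A ∩ j.1 ∪ {f j}) := by
        by_contra! hcon
        exact h.1 A hA (hcount.mono hcon)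
      refine ⟨x, hL A hA hxA, fun j => ⟨fun hj => hx ?_, fun hj => hx ?_⟩⟩
      · exact mem_iUnion.2 ⟨j, Or.inl ⟨hxA, hj⟩⟩
      · exact mem_iUnion.2 ⟨j, Or.inr hj⟩
  have htri : ∀ i j, r i j ∨ i = j ∨ r j i := fun i j =>
    trichotomous_of r i j
  have hinj : Function.Injective b := by
    intro i j hij
    rcases htri i j with h | h | h
    · exact absurd hij.symm ((hb j).2 ⟨i, h⟩).2
    · exact h
    · exact absurd hij ((hb i).2 ⟨j, h⟩).2
  refine ⟨range b, ?_, fun hcb => hunc ?_, fun A hA => ?_⟩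
  · rintro _ ⟨i, rfl⟩
    exact (hb i).1
  · rw [← image_univ] at hcb
    exact countable_coe_iff.1 (countable_univ_iff.1
      (countable_of_injective_of_countable_image hinj.injOn hcb))
  · refine (((hc ⟨A, hA⟩).union (countable_singleton ⟨A, hA⟩)).image b).mono ?_
    rintro _ ⟨⟨i, rfl⟩, hi⟩
    rcases htri i ⟨A, hA⟩ with h | h | h
    · exact ⟨i, Or.inl h, rfl⟩
    · exact ⟨i, Or.inr h, rfl⟩
    · exact absurd hi ((hb i).2 ⟨⟨A, hA⟩, h⟩).1

/-- A maximal family extending an uncountable partition cannot have size at most `ℵ₁`, since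
diagonalisation would enlarge it. -/
theorem exists_large_almostDisjoint {L : Set X} (hL : #L = aleph 1) :
    ∃ 𝒜 : Set (Set X), IsAlmostDisjoint 𝒜 ∧ (∀ A ∈ 𝒜, A ⊆ L) ∧ aleph 1 < #𝒜 := by
  obtain ⟨ℬ, hℬ, hℬL, hℬc⟩ := exists_uncountable_partition hL
  obtain ⟨𝒜, hℬ𝒜, hmax⟩ := zorn_subset_nonempty
    {𝒜 : Set (Set X) | IsAlmostDisjoint 𝒜 ∧ ∀ A ∈ 𝒜, A ⊆ L}
    (fun c hcs hc _ => ⟨⋃₀ c, ⟨IsAlmostDisjoint.sUnion hc fun 𝒜 h => (hcs h).1,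
      fun A ⟨𝒜, h𝒜, hA⟩ => (hcs h𝒜).2 A hA⟩, fun s hs => subset_sUnion_of_mem hs⟩)
    ℬ ⟨hℬ, hℬL⟩
  refine ⟨𝒜, hmax.prop.1, hmax.prop.2, ?_⟩
  by_contra hle
  obtain ⟨B, hBL, hB, hBA⟩ := hmax.prop.1.exists_countable_inter hmax.prop.2
    (fun h => hℬc (h.mono hℬ𝒜)) (not_lt.1 hle)
  have hmem : B ∈ 𝒜 := by
    refine hmax.le_of_ge (y := insert B 𝒜) ⟨⟨?_, ?_⟩, ?_⟩ (subset_insert _ _) (mem_insert _ _)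
    · rintro A (rfl | hA)
      exacts [hB, hmax.prop.1.1 A hA]
    · rintro A (rfl | hA) C (rfl | hC) hAC
      · exact absurd rfl hAC
      · exact hBA C hC
      · rw [inter_comm]
        exact hBA A hA
      · exact hmax.prop.1.2 A hA C hC hAC
    · rintro A (rfl | hA)
      exacts [hBL, hmax.prop.2 A hA]
  exact hB (by simpa using hBA B hmem)

end SetTheory

/-! ### Condensation points, saturated families and countable tightness -/

section Topology

variable {X : Type u} [TopologicalSpace X]

/-- Points all of whose neighbourhoods meet `A` in an uncountable set. -/
def condensationPoints (A : Set X) : Set X := {x | ∀ U ∈ 𝓝 x, ¬ (A ∩ U).Countable}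

theorem condensationPoints_mono {A B : Set X} (h : A ⊆ B) :
    condensationPoints A ⊆ condensationPoints B := fun _ hx U hU hc =>
  hx U hU (hc.mono (inter_subset_inter_left U h))

theorem mem_closure_inter_diff_of_mem_condensationPoints {A G Q : Set X} {x : X}
    (hx : x ∈ condensationPoints A) (hG : IsOpen G) (hxG : x ∈ G) (hQ : (A ∩ Q).Countable) :
    x ∈ closure ((A \ Q) ∩ G) := by
  rw [mem_closure_iff_nhds]
  intro U hU
  by_contra hne
  refine hx (U ∩ G) (inter_mem hU (hG.mem_nhds hxG)) (hQ.mono ?_)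
  rintro y ⟨hyA, hyU, hyG⟩
  by_contra hy
  exact hne ⟨y, hyU, ⟨hyA, fun hq => hy ⟨hyA, hq⟩⟩, hyG⟩

theorem IsLindelof.exists_mem_condensationPoints {L B : Set X} (hL : IsLindelof L) (hBL : B ⊆ L)
    (hB : ¬ B.Countable) : ∃ x ∈ L, x ∈ condensationPoints B := by
  by_contra! hcon
  have : ∀ x : X, ∃ U : Set X, x ∈ L → U ∈ 𝓝 x ∧ (B ∩ U).Countable := fun x => by
    by_cases hx : x ∈ L
    · have := hcon x hx
      simp only [condensationPoints, mem_ofPred_eq, not_forall, not_not] at this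
      obtain ⟨U, hU, h⟩ := this
      exact ⟨U, fun _ => ⟨hU, h⟩⟩
    · exact ⟨∅, fun h => absurd h hx⟩
  choose U hU using this
  obtain ⟨t, htc, htL, hcov⟩ := hL.elim_nhds_subcover U fun x hx => (hU x hx).1
  refine hB ((htc.biUnion fun x hx => (hU x (htL x hx)).2).mono fun y hy => ?_)
  obtain ⟨x, hx, hyx⟩ := mem_iUnion₂.1 (hcov (hBL hy))
  exact mem_iUnion₂.2 ⟨x, hx, hy, hyx⟩

/-- The members of a family that condense at `x`. -/
def condensingAt (𝒜 : Set (Set X)) (x : X) : Set (Set X) := {A ∈ 𝒜 | x ∈ condensationPoints A}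

theorem condensingAt_mono {𝒜 ℬ : Set (Set X)} (h : 𝒜 ⊆ ℬ) (x : X) :
    condensingAt 𝒜 x ⊆ condensingAt ℬ x := fun _ hA => ⟨h hA.1, hA.2⟩

/-- An almost disjoint family with more than `ℵ₁` members condensing at each point at which one
of its members condenses. -/
structure IsSaturated (𝒜 : Set (Set X)) : Prop where
  almostDisjoint : IsAlmostDisjoint 𝒜
  large : ∀ A ∈ 𝒜, ∀ x ∈ condensationPoints A, aleph 1 < #(condensingAt 𝒜 x)

theorem IsAlmostDisjoint.exists_isSaturated_subset (hX : #X ≤ aleph 1) {𝒜 : Set (Set X)}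
    (h𝒜 : IsAlmostDisjoint 𝒜) (hcard : aleph 1 < #𝒜) :
    ∃ 𝒦 ⊆ 𝒜, 𝒦.Nonempty ∧ IsSaturated 𝒦 := by
  have h0 : ℵ₀ ≤ aleph 1 := Cardinal.aleph0_le_aleph 1
  -- Members condensing at some poorly served point; there are at most `ℵ₁` of them, so discarding
  -- them leaves large families large.
  let N : Set (Set X) := ⋃ x : {x // #(condensingAt 𝒜 x) ≤ aleph 1}, condensingAt 𝒜 x
  have hN : #N ≤ aleph 1 := by
    refine (Cardinal.mk_iUnion_le _).trans ?_
    refine (mul_le_mul' ((Cardinal.mk_subtype_le _).trans hX)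
      (ciSup_le' fun x => x.2)).trans ?_
    rw [Cardinal.mul_eq_self h0]
  have hdiff : ∀ ℬ : Set (Set X), aleph 1 < #ℬ → aleph 1 < #(ℬ \ N : Set (Set X)) := by
    intro ℬ hℬ
    by_contra hle
    refine absurd hℬ (not_lt.2 ?_)
    calc #ℬ ≤ #((ℬ \ N) ∪ N : Set (Set X)) :=
          Cardinal.mk_le_mk_of_subset (by rw [sdiff_union_self]; exact subset_union_left)
      _ ≤ _ := Cardinal.mk_union_le _ _
      _ ≤ aleph 1 + aleph 1 := add_le_add (not_lt.1 hle) hN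
      _ = aleph 1 := Cardinal.add_eq_self h0
  refine ⟨𝒜 \ N, sdiff_subset, ?_, h𝒜.mono sdiff_subset, ?_⟩
  · by_contra hne
    have := hdiff 𝒜 hcard
    rw [not_nonempty_iff_eq_empty.1 hne] at this
    simp at this
  · rintro A ⟨hA, hAN⟩ x hx
    have hbig : aleph 1 < #(condensingAt 𝒜 x) := by
      by_contra hle
      exact hAN (mem_iUnion.2 ⟨⟨x, not_lt.1 hle⟩, hA, hx⟩)
    exact (hdiff _ hbig).trans_le
      (Cardinal.mk_le_mk_of_subset fun B hB => ⟨⟨hB.1.1, hB.2⟩, hB.1.2⟩)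

theorem exists_maximal_isSaturated : ∃ 𝒦 : Set (Set X), Maximal IsSaturated 𝒦 := by
  obtain ⟨𝒦, h⟩ := zorn_subset {𝒜 : Set (Set X) | IsSaturated 𝒜} fun c hcs hc =>
    ⟨⋃₀ c, ⟨IsAlmostDisjoint.sUnion hc fun 𝒜 h => (hcs h).1, fun A ⟨𝒜, h𝒜, hA⟩ x hx =>
      ((hcs h𝒜).2 A hA x hx).trans_le (Cardinal.mk_le_mk_of_subset
        (condensingAt_mono (subset_sUnion_of_mem h𝒜) x))⟩, fun s hs => subset_sUnion_of_mem hs⟩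
  exact ⟨𝒦, h⟩

/-- An uncountable `L` would carry a saturated family almost disjoint from `𝒦`, which could be added
to it. -/
theorem Maximal.countable_of_isLindelof (hX : #X ≤ aleph 1) {𝒦 : Set (Set X)}
    (h𝒦 : Maximal IsSaturated 𝒦) {L : Set X} (hL : IsLindelof L)
    (hdisj : ∀ A ∈ 𝒦, Disjoint L (condensationPoints A)) : L.Countable := by
  by_contra hLc
  have hLcard : #L = aleph 1 := by
    refine le_antisymm ((Cardinal.mk_subtype_le _).trans hX) (Cardinal.aleph_one_le_iff.2 ?_)
    rw [← not_le, Cardinal.le_aleph0_iff_set_countable]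
    exact hLc
  obtain ⟨𝒜, h𝒜, h𝒜L, h𝒜c⟩ := exists_large_almostDisjoint hLcard
  obtain ⟨ℬ, hℬ𝒜, ⟨B, hB⟩, hℬ⟩ := h𝒜.exists_isSaturated_subset hX h𝒜c
  have hAL : ∀ A ∈ 𝒦, (A ∩ L).Countable := fun A hA => by
    by_contra hc
    obtain ⟨x, hxL, hx⟩ := hL.exists_mem_condensationPoints inter_subset_right hc
    exact disjoint_left.1 (hdisj A hA) hxL (condensationPoints_mono inter_subset_left hx)
  have hunion : IsSaturated (𝒦 ∪ ℬ) := by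
    refine ⟨⟨?_, ?_⟩, ?_⟩
    · rintro A (hA | hA)
      exacts [h𝒦.prop.1.1 A hA, hℬ.1.1 A hA]
    · rintro A (hA | hA) C (hC | hC) hAC
      · exact h𝒦.prop.1.2 A hA C hC hAC
      · exact (hAL A hA).mono (inter_subset_inter_right _ (h𝒜L C (hℬ𝒜 hC)))
      · rw [inter_comm]
        exact (hAL C hC).mono (inter_subset_inter_right _ (h𝒜L A (hℬ𝒜 hA)))
      · exact hℬ.1.2 A hA C hC hAC
    · rintro A (hA | hA) x hx
      · exact (h𝒦.prop.2 A hA x hx).trans_le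
          (Cardinal.mk_le_mk_of_subset (condensingAt_mono subset_union_left x))
      · exact (hℬ.2 A hA x hx).trans_le
          (Cardinal.mk_le_mk_of_subset (condensingAt_mono subset_union_right x))
  have hBK : B ∈ 𝒦 := h𝒦.le_of_ge hunion subset_union_left (Or.inr hB)
  obtain ⟨x, hxL, hx⟩ := hL.exists_mem_condensationPoints (h𝒜L B (hℬ𝒜 hB)) (hℬ.1.1 B hB)
  exact disjoint_left.1 (hdisj B hBK) hxL hx

/-- The points of `O` outside all closures of countable subsets of `A` form an open set. This is
tested on Lindelöf `L`: regularity gives a closed neighbourhood inside `O`, whose trace on `L` is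
countable, so countably many witnesses merge into one. -/
theorem exists_countable_mem_closure [RegularSpace X] (hgen : LindelofGenerated X) {O : Set X}
    (hO : IsOpen O) (hOL : ∀ L ⊆ O, IsLindelof L → L.Countable) {A : Set X}
    {x : X} (hxO : x ∈ O) (hx : x ∈ closure A) :
    ∃ C ⊆ A, C.Countable ∧ x ∈ closure C := by
  let B : Set X := {y | y ∈ O ∧ ∃ C ⊆ A, C.Countable ∧ y ∈ closure C}
  have hW : IsOpen (O \ B) := by
    refine (Topology.IsCoherentWith.isOpen_iff hgen).2 fun L hL => ?_
    rw [isOpen_iff_mem_nhds]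
    rintro ⟨y, hyL⟩ ⟨hyO, hyB⟩
    obtain ⟨V, hV, hVc, hVO⟩ := exists_mem_nhds_isClosed_subset (hO.mem_nhds hyO)
    have hcount : (L ∩ V).Countable :=
      hOL _ (inter_subset_right.trans hVO) (hL.inter_right hVc)
    have hch : ∀ z : X, ∃ C ⊆ A, C.Countable ∧ (z ∈ B → z ∈ closure C) := fun z => by
      by_cases hz : z ∈ B
      · obtain ⟨C, h1, h2, h3⟩ := hz.2
        exact ⟨C, h1, h2, fun _ => h3⟩
      · exact ⟨∅, empty_subset _, countable_empty, fun h => absurd h hz⟩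
    choose C hCA hCc hC using hch
    have hyC : y ∉ closure (⋃ z ∈ L ∩ V, C z) := fun h =>
      hyB ⟨hyO, _, iUnion₂_subset fun z _ => hCA z, hcount.biUnion fun z _ => hCc z, h⟩
    have hnhds : V ∩ (closure (⋃ z ∈ L ∩ V, C z))ᶜ ∈ 𝓝 y :=
      inter_mem hV (isClosed_closure.isOpen_compl.mem_nhds hyC)
    refine mem_of_superset (continuous_subtype_val.continuousAt.preimage_mem_nhds hnhds) ?_
    rintro ⟨z, hzL⟩ ⟨hzV, hz⟩
    refine ⟨hVO hzV, fun hzB => hz ?_⟩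
    exact closure_mono (subset_biUnion_of_mem (u := C) (show z ∈ L ∩ V from ⟨hzL, hzV⟩))
      (hC z hzB)
  by_contra hcon
  have hxW : x ∈ O \ B := ⟨hxO, fun h => hcon h.2⟩
  obtain ⟨a, ⟨haO, haB⟩, haA⟩ := mem_closure_iff.1 hx _ hW hxW
  exact haB ⟨haO, {a}, singleton_subset_iff.2 haA, countable_singleton a,
    subset_closure (mem_singleton a)⟩

theorem exists_disjoint_subsets_condensing {I : Type u} (hI : #I ≤ aleph 1) {𝒦 : Set (Set X)}
    (h𝒦 : IsAlmostDisjoint 𝒦) {G : Set X} (hG : IsOpen G) (p : I → X)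
    (hp : ∀ i, aleph 1 < #(condensingAt 𝒦 (p i))) :
    ∃ B : I → Set X, Pairwise (fun i j => Disjoint (B i) (B j)) ∧ (∀ i, B i ⊆ G) ∧
      ∀ i, p i ∈ G → p i ∈ closure (B i) := by
  obtain ⟨A, hAinj, hA⟩ := exists_injective_choice hI _ hp
  obtain ⟨r, hr, hc⟩ := exists_wellOrder_countable_initial hI
  refine ⟨fun i => (A i \ ⋃ j ∈ {j | r j i}, A j) ∩ G, fun i j hij => ?_,
    fun i => inter_subset_right, fun i hi => ?_⟩
  · refine disjoint_left.2 ?_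
    rintro x ⟨⟨hxi, hxi'⟩, -⟩ ⟨⟨hxj, hxj'⟩, -⟩
    rcases trichotomous_of r i j with h | h | h
    · exact hxj' (mem_iUnion₂.2 ⟨i, h, hxi⟩)
    · exact hij h
    · exact hxi' (mem_iUnion₂.2 ⟨j, h, hxj⟩)
  · refine mem_closure_inter_diff_of_mem_condensationPoints (hA i).2 hG hi ?_
    rw [inter_iUnion₂]
    refine (hc i).biUnion fun j hj => h𝒦.2 _ (hA i).1 _ (hA j).1 fun h => ?_
    have : i = j := hAinj h
    subst this
    exact irrefl_of r _ hj

theorem exists_disjoint_subsets_mem_closure {I : Type u} (hI : #I ≤ aleph 1) {O : Set X}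
    (p : I → X) (hp : ∀ i, ∀ Q : Set X, Q.Countable →
      ∃ C ⊆ O \ Q, C.Countable ∧ p i ∈ closure C) :
    ∃ C : I → Set X, Pairwise (fun i j => Disjoint (C i) (C j)) ∧ (∀ i, C i ⊆ O) ∧
      ∀ i, p i ∈ closure (C i) := by
  obtain ⟨r, hr, hc⟩ := exists_wellOrder_countable_initial hI
  obtain ⟨C, hC⟩ := exists_choice_of_earlier hr.wf
    (fun i (f : {j // r j i} → {s : Set X // s.Countable}) s =>
      s.1 ⊆ O \ (⋃ j, (f j).1) ∧ p i ∈ closure s.1) fun i f => by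
      have : Countable {j // r j i} := (hc i).to_subtype
      obtain ⟨s, h1, h2, h3⟩ := hp i (⋃ j, (f j).1) (countable_iUnion fun j => (f j).2)
      exact ⟨⟨s, h2⟩, h1, h3⟩
  have hdis : ∀ i j, r i j → Disjoint (C i).1 (C j).1 := fun i j hij => by
    rw [disjoint_right]
    intro x hxj hxi
    exact ((hC j).1 hxj).2 (mem_iUnion.2 ⟨⟨i, hij⟩, hxi⟩)
  refine ⟨fun i => (C i).1, fun i j hij => ?_, fun i => (hC i).1.trans sdiff_subset,
    fun i => (hC i).2⟩
  rcases trichotomous_of r i j with h | h | h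
  · exact hdis i j h
  · exact absurd h hij
  · exact (hdis j i h).symm

theorem resolvable_of_pairwise_disjoint [Nonempty X] {I : Type u} {D : I → Set X}
    (hd : ∀ i, Dense (D i)) (hdis : Pairwise fun i j => Disjoint (D i) (D j)) :
    Resolvable #I X := by
  have hinj : Function.Injective D := fun i j hij => by
    by_contra hne
    obtain ⟨x, hx⟩ := (hd i).nonempty
    exact disjoint_left.1 (hdis hne) hx (hij ▸ hx)
  refine ⟨range D, Cardinal.mk_range_eq D hinj, ?_, ?_⟩
  · rintro _ ⟨i, rfl⟩
    exact hd i
  · rintro _ ⟨i, rfl⟩ _ ⟨j, rfl⟩ hne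
    exact hdis fun h => hne (congrArg D h)

theorem not_countable_of_isOpen (hdisp : dispersionCharacter X = aleph 1) {U : Set X}
    (hU : IsOpen U) (hne : U.Nonempty) : ¬ U.Countable :=
  not_countable_of_aleph_one_le (hdisp ▸ csInf_le' ⟨U, hU, hne, rfl⟩)

end Topology

theorem theorem2p1 (X : Type u) [TopologicalSpace X] [RegularSpace X]
    (hgen : LindelofGenerated X) (hcard : Cardinal.mk X = Cardinal.aleph 1)
    (hdisp : dispersionCharacter X = Cardinal.aleph 1) :
    Resolvable (Cardinal.aleph 1) X := by
  have hX : #X ≤ aleph 1 := hcard.le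
  have hmul : ∀ S : Set X, #(S × X) ≤ aleph 1 := fun S => by
    rw [Cardinal.mk_prod, Cardinal.lift_id, Cardinal.lift_id,
      ← Cardinal.mul_eq_self (Cardinal.aleph0_le_aleph 1)]
    exact mul_le_mul' ((Cardinal.mk_subtype_le _).trans hX) hX
  have : Nonempty X := by
    rw [← Cardinal.mk_ne_zero_iff, hcard]
    exact (Cardinal.aleph_pos 1).ne'
  obtain ⟨𝒦, h𝒦⟩ := exists_maximal_isSaturated (X := X)
  let Z : Set X := ⋃ A ∈ 𝒦, condensationPoints A
  let O : Set X := (closure Z)ᶜ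
  let G : Set X := interior (closure Z)
  have hO : IsOpen O := isClosed_closure.isOpen_compl
  have hOL : ∀ L ⊆ O, IsLindelof L → L.Countable := fun L hLO hL =>
    h𝒦.countable_of_isLindelof hX hL fun A hA => disjoint_left.2 fun x hxL hxA =>
      hLO hxL (subset_closure (mem_iUnion₂.2 ⟨A, hA, hxA⟩))
  -- Indexing by pairs serves each point once for every label `γ : X`.
  obtain ⟨B, hBdis, hBG, hB⟩ := exists_disjoint_subsets_condensing (hmul Z) h𝒦.prop.1
    (isOpen_interior : IsOpen G) (fun i => i.1.1) fun i => by
      obtain ⟨A, hA, hx⟩ := mem_iUnion₂.1 i.1.2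
      exact h𝒦.prop.2 A hA _ hx
  obtain ⟨C, hCdis, hCO, hC⟩ := exists_disjoint_subsets_mem_closure (hmul O) (O := O)
    (fun i => i.1.1) fun i Q hQ => by
      refine exists_countable_mem_closure hgen hO hOL i.1.2 (mem_closure_iff.2 fun U hU hxU => ?_)
      by_contra hne
      -- Nonempty open sets are uncountable, so removing a countable `Q` keeps `O` dense at its
      -- points.
      refine not_countable_of_isOpen hdisp (hU.inter hO) ⟨i.1.1, hxU, i.1.2⟩ (hQ.mono ?_)
      rintro y ⟨hyU, hyO⟩
      by_contra hy
      exact hne ⟨y, hyU, hyO, hy⟩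
  have hGO : Disjoint G O := disjoint_compl_right.mono_left interior_subset
  rw [← hcard]
  refine resolvable_of_pairwise_disjoint
    (D := fun γ : X => (⋃ z : Z, B (z, γ)) ∪ ⋃ x : O, C (x, γ)) (fun γ => ?_) fun γ δ hγδ => ?_
  · have hZD : Z ∩ G ⊆ closure ((⋃ z : Z, B (z, γ)) ∪ ⋃ x : O, C (x, γ)) := fun z hz =>
      closure_mono (subset_union_of_subset_left (subset_iUnion (fun z : Z => B (z, γ)) ⟨z, hz.1⟩) _)
        (hB (⟨z, hz.1⟩, γ) hz.2)
    have hOD : O ⊆ closure ((⋃ z : Z, B (z, γ)) ∪ ⋃ x : O, C (x, γ)) := fun x hx =>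
      closure_mono (subset_union_of_subset_right (subset_iUnion (fun x : O => C (x, γ)) ⟨x, hx⟩) _)
        (hC (⟨x, hx⟩, γ))
    rw [← dense_closure, dense_iff_inter_open]
    intro U hU hne
    by_cases h : (U ∩ O).Nonempty
    · obtain ⟨x, hxU, hxO⟩ := h
      exact ⟨x, hxU, hOD hxO⟩
    · have hUZ : U ⊆ closure Z := fun x hxU => by
        by_contra hx
        exact h ⟨x, hxU, hx⟩
      have hUG : U ⊆ G := interior_maximal hUZ hU
      obtain ⟨x, hxU⟩ := hne
      obtain ⟨z, hzU, hzZ⟩ := mem_closure_iff.1 (hUZ hxU) U hU hxU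
      exact ⟨z, hzU, hZD ⟨hzZ, hUG hzU⟩⟩
  · simp only [disjoint_union_left, disjoint_union_right, disjoint_iUnion_left,
      disjoint_iUnion_right]
    exact ⟨fun z => ⟨fun w => hBdis fun h => hγδ (congrArg Prod.snd h),
      fun x => hGO.symm.mono (hCO _) (hBG _)⟩,
      fun x => ⟨fun z => hGO.mono (hBG _) (hCO _),
        fun y => hCdis fun h => hγδ (congrArg Prod.snd h)⟩⟩
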